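/- Consider $n=3f+1$ replicas, a fixed set of at most $f$ of which is Byzantine (the others are honest), under round-robin leader rotation: the leader of view $v$ is replica $v \bmod n$. They run the following chained, leader-speaks-once BFT protocol with unforgeable signatures and collision-free hashes. **Blocks and certificates.** A block carries its height, its parent, a batch of valid transactions, its view, a quorum certificate (QC) and the signature of its proposer; a slow block also carries $n-f$ NEW-VIEW messages and equivocation evidence. Write $B\leftarrow B'$ if $B$ is $B'$ or an ancestor of $B'$. A QC for $B$ consists of votes by $n-f$ distinct replicas for blocks $B'$ with $B\leftarrow B'$, and its view is that of $B$. The genesis block and its QC have view $0$; replicas start in view $1$. **Replicas.** A replica in view $v$ votes for a valid VOTE-REQ, i.e. a valid block of view $v$ signed by the leader of $v$; it then stores the block (as its latest VOTE-REQ, with the QC in it) and its vote, applies the commit rule, sends the vote to the leader of $v+1$ and enters $v+1$. If a timer of length at least $\tau$, set with that vote, expires before it has received a valid block of view $v+1$, it sends a NEW-VIEW message for $v+1$ to that leader. A replica that has received no valid block of its view $v$ may also be moved by the pacemaker from $v$ to $v+1$, and then sends a NEW-VIEW message for $v+1$. NEW-VIEW messages contain the sender's latest VOTE-REQ, the QC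 in it, and its latest vote. **Leaders.** The leader of $v$ proposes once: a fast block, when it has $n-f$ votes for a block of view $v-1$ (this block is the parent and these votes form the QC), or a slow block, when it has a set $S$ of $n-f$ NEW-VIEW messages for $v$. For a slow block, let $QC_{high}$ be the highest QC in $S$, let $QC_{choice}$ be the higher of $QC_{high}$ and the QC that the votes in $S$ form for the highest common non-genesis ancestor of the blocks voted for (if its block extends that of $QC_{high}$), and let $highVote$ be the highest VOTE-REQ in $S$. If the block of $QC_{choice}$ is not $\leftarrow highVote$, then: if $highVote$ stores $n-f$ NEW-VIEW messages not containing $QC_{choice}$, set $QC_{choice}$ to the QC of $highVote$; otherwise set $highVote$ to the highest VOTE-REQ in $S$ containing $QC_{choice}$ (to the block of $QC_{choice}$ if there is none). The slow block has parent $highVote$, certificate $QC_{choice}$, the set $S$, and as evidence all VOTE-REQs in $S$ of equal view for different blocks. A slow block is valid only if it was so formed. Replicas ignore all later messages from leaders exposed by such evidence. **Commit rule.** On accepting $B$, let $B_1$ be the block certified by the QC of $B$, and $B_0$ the block certified by the QC of $B_1$. Then $B_0$ and its ancestors are committed if $B_1$ has view one more than $B_0$, or if no block on the chain from $B_1$ back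 to the view of $B_0$ stores a VOTE-REQ of at least the view of $B_0$ that does not extend $B_0$. **Timing.** Honest replicas compute in zero time. Messages between honest replicas arrive within $\Delta$ after the later of sending and the Global Stabilization Time GST. Faulty replicas may send anything (in particular, equivocate) except forged signatures of honest replicas. A view is *after GST* if no honest replica has reached it before GST. The pacemaker guarantees that no honest replica stays in a view forever, and that, for every view $u$ after GST with an honest leader that some honest replica enters, all honest replicas enter $u$ within time $T_f$ of the first one that does, and receive, while in $u$, a block proposed by the leader of $u$. Timers are long enough: $\tau > T_f+2\Delta$. **Theorem (liveness).** In every such execution, if $v$ is a view after GST, then there are a view $v'>v$ and a block $B$ proposed in view $v'$ such that every honest replica eventually commits $B$. -/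

import Mathlib

/-!
The chained, leader-speaks-once BFT protocol, as a transition system of `3 f + 1` replicas with
ideal (unforgeable) signatures and ideal (injective) hash pointers: a pointer to a block is
represented by the block itself.
-/

namespace ChainedBFT

/-- The `n = 3 f + 1` replicas. -/
abbrev Replica (f : ℕ) : Type := Fin (3 * f + 1)

/-- The quorum size `n - f`. -/
def quorum (f : ℕ) : ℕ := 2 * f + 1

/-- Round-robin leader rotation. -/
def leader (f v : ℕ) : Replica f := ⟨v % (3 * f + 1), Nat.mod_lt v (Nat.succ_pos _)⟩

/-! ### Blocks, certificates and messages -/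

mutual

/-- Blocks, signed by the replica that proposes them (the genesis block is unsigned).
A signed block is also the content of a VOTE-REQ message. -/
inductive Block (f : ℕ) (Tx : Type) : Type
  | genesis : Block f Tx
  | fast (height : ℕ) (parent : Block f Tx) (batch : List Tx) (view : ℕ) (qc : QC f Tx)
      (signer : Replica f) : Block f Tx
  | slow (height : ℕ) (parent : Block f Tx) (batch : List Tx) (view : ℕ) (qc : QC f Tx)
      (newViews : List (NewView f Tx)) (evidence : List (Block f Tx))
      (signer : Replica f) : Block f Tx

/-- Quorum certificates `(v, B, σ)`; the genesis certificate needs no votes. -/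
inductive QC (f : ℕ) (Tx : Type) : Type
  | genesis : QC f Tx
  | cert (view : ℕ) (block : Block f Tx) (votes : List (Vote f Tx)) : QC f Tx

/-- Signed VOTE-RESP messages. -/
inductive Vote (f : ℕ) (Tx : Type) : Type
  | mk (block : Block f Tx) (signer : Replica f) : Vote f Tx

/-- Signed NEW-VIEW messages: the view to be started, the certificate `QC_r`, the highest
VOTE-REQ received `vr_r`, the highest VOTE-RESP sent `vp_r` (if any), and the signer. -/
inductive NewView (f : ℕ) (Tx : Type) : Type
  | mk (view : ℕ) (qc : QC f Tx) (voteReq : Block f Tx) (voteResp : Option (Vote f Tx))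
      (signer : Replica f) : NewView f Tx

end

section Accessors

variable {f : ℕ} {Tx : Type}

def Block.height : Block f Tx → ℕ
  | .genesis => 0
  | .fast h _ _ _ _ _ => h
  | .slow h _ _ _ _ _ _ _ => h

def Block.parent? : Block f Tx → Option (Block f Tx)
  | .genesis => none
  | .fast _ p _ _ _ _ => some p
  | .slow _ p _ _ _ _ _ _ => some p

def Block.view : Block f Tx → ℕ
  | .genesis => 0
  | .fast _ _ _ v _ _ => v
  | .slow _ _ _ v _ _ _ _ => v

def Block.qc : Block f Tx → QC f Tx
  | .genesis => .genesis
  | .fast _ _ _ _ q _ => q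
  | .slow _ _ _ _ q _ _ _ => q

/-- The NEW-VIEW messages stored in a block; fast blocks store none. -/
def Block.newViews : Block f Tx → List (NewView f Tx)
  | .slow _ _ _ _ _ S _ _ => S
  | _ => []

/-- The equivocation evidence stored in a block; the empty list stands for `⊥`. -/
def Block.evidence : Block f Tx → List (Block f Tx)
  | .slow _ _ _ _ _ _ π _ => π
  | _ => []

def Block.signer? : Block f Tx → Option (Replica f)
  | .genesis => none
  | .fast _ _ _ _ _ r => some r
  | .slow _ _ _ _ _ _ _ r => some r

def QC.view : QC f Tx → ℕ
  | .genesis => 0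
  | .cert v _ _ => v

def QC.block : QC f Tx → Block f Tx
  | .genesis => .genesis
  | .cert _ b _ => b

def QC.votes : QC f Tx → List (Vote f Tx)
  | .genesis => []
  | .cert _ _ σ => σ

def Vote.block : Vote f Tx → Block f Tx
  | .mk b _ => b

def Vote.signer : Vote f Tx → Replica f
  | .mk _ r => r

def NewView.view : NewView f Tx → ℕ
  | .mk v _ _ _ _ => v

def NewView.qc : NewView f Tx → QC f Tx
  | .mk _ q _ _ _ => q

def NewView.voteReq : NewView f Tx → Block f Tx
  | .mk _ _ b _ _ => b

def NewView.voteResp : NewView f Tx → Option (Vote f Tx)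
  | .mk _ _ _ x _ => x

def NewView.signer : NewView f Tx → Replica f
  | .mk _ _ _ _ r => r

/-- `Extends b c` (written `b ⟵ c` on paper): `b` is `c` or an ancestor of `c`. -/
def Extends (b c : Block f Tx) : Prop :=
  Relation.ReflTransGen (fun x y : Block f Tx => y.parent? = some x) b c

/-- Two certificates are for the same block and view (the sets of signatures may differ). -/
def QC.Same (Q Q' : QC f Tx) : Prop := Q.view = Q'.view ∧ Q.block = Q'.block

end Accessors

/-! ### The choice made by the leader in a slow view change -/

section SlowViewChange

variable {f : ℕ} {Tx : Type}

/-- The implicit certificate of a set `S` of NEW-VIEW messages: the votes in `S` certify the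
greatest (by view) common ancestor of the blocks voted for, unless it is the genesis block.
When all votes are for one block, this ancestor is that block itself. -/
def IsImplicitQC (S : List (NewView f Tx)) (Q : QC f Tx) : Prop :=
  ∃ (b : Block f Tx) (σ : List (Vote f Tx)),
    Q = QC.cert b.view b σ ∧ S.map NewView.voteResp = σ.map some ∧ b ≠ Block.genesis ∧
    (∀ x ∈ σ, Extends b x.block) ∧
    ∀ c : Block f Tx, (∀ x ∈ σ, Extends c x.block) → c.view ≤ b.view

/-- `QC_high`: a certificate of highest view among those in `S`. -/
def IsHighQC (S : List (NewView f Tx)) (Q : QC f Tx) : Prop :=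
  Q ∈ S.map NewView.qc ∧ ∀ Q' ∈ S.map NewView.qc, Q'.view ≤ Q.view

/-- `QC_choice`: of `QC_high` and the implicit certificate, the one of highest view whose block
extends the block of `QC_high`. -/
def IsChoiceQC (S : List (NewView f Tx)) (Q : QC f Tx) : Prop :=
  ∃ Qhigh, IsHighQC S Qhigh ∧
    (Q = Qhigh ∨ (IsImplicitQC S Q ∧ Extends Qhigh.block Q.block)) ∧
    Qhigh.view ≤ Q.view ∧
    ∀ Q', IsImplicitQC S Q' → Extends Qhigh.block Q'.block → Q'.view ≤ Q.view

/-- `highVote`: a VOTE-REQ of highest view among those in `S` that satisfy `P`. -/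
def IsHighVote (S : List (NewView f Tx)) (P : Block f Tx → Prop) (b : Block f Tx) : Prop :=
  b ∈ S.map NewView.voteReq ∧ P b ∧ ∀ c ∈ S.map NewView.voteReq, P c → c.view ≤ b.view

/-- The NEW-VIEW message `m` contains the certificate `Q`. -/
def NewView.Contains (m : NewView f Tx) (Q : QC f Tx) : Prop :=
  QC.Same m.qc Q ∨ QC.Same m.voteReq.qc Q

/-- `b` stores `n - f` NEW-VIEW messages that do not contain `Q`. -/
def RulesOut (b : Block f Tx) (Q : QC f Tx) : Prop :=
  ∃ T : List (NewView f Tx), T.Sublist b.newViews ∧ T.length = quorum f ∧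
    ∀ m ∈ T, ¬ m.Contains Q

/-- `SlowChoice S p Q`: given the NEW-VIEW messages `S`, the new slow block may have parent `p`
and certificate `Q`. Ties between maxima of equal view may be broken in any way. -/
inductive SlowChoice (S : List (NewView f Tx)) : Block f Tx → QC f Tx → Prop
  /-- the highest VOTE-REQ extends the chosen certificate -/
  | extend (b : Block f Tx) (Q : QC f Tx) (hQ : IsChoiceQC S Q)
      (hb : IsHighVote S (fun _ => True) b) (h : Extends Q.block b) : SlowChoice S b Q
  /-- it does not, but shows that the chosen certificate could not have led to a commit -/
  | ruledOut (b : Block f Tx) (Q : QC f Tx) (hQ : IsChoiceQC S Q)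
      (hb : IsHighVote S (fun _ => True) b) (h : ¬ Extends Q.block b)
      (hr : RulesOut b Q) : SlowChoice S b b.qc
  /-- otherwise the highest VOTE-REQ that contains the chosen certificate is extended -/
  | keep (b c : Block f Tx) (Q : QC f Tx) (hQ : IsChoiceQC S Q)
      (hb : IsHighVote S (fun _ => True) b) (h : ¬ Extends Q.block b)
      (hr : ¬ RulesOut b Q) (hc : IsHighVote S (fun d => QC.Same d.qc Q) c) : SlowChoice S c Q
  /-- and if no VOTE-REQ contains the chosen certificate, the block it certifies -/
  | direct (b : Block f Tx) (Q : QC f Tx) (hQ : IsChoiceQC S Q)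
      (hb : IsHighVote S (fun _ => True) b) (h : ¬ Extends Q.block b)
      (hr : ¬ RulesOut b Q) (hc : ∀ d ∈ S.map NewView.voteReq, ¬ QC.Same d.qc Q) :
      SlowChoice S Q.block Q

/-- `π` lists the VOTE-REQ messages in `S` that conflict with another one of the same view. -/
def IsEvidence (S : List (NewView f Tx)) (π : List (Block f Tx)) : Prop :=
  ∀ b, b ∈ π ↔ b ∈ S.map NewView.voteReq ∧
    ∃ c ∈ S.map NewView.voteReq, c.view = b.view ∧ c ≠ b

end SlowViewChange

/-! ### Validity -/

mutual

/-- A valid block has a valid parent, valid transactions, valid certificates and messages, is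
signed by the leader of its view, and was formed according to the rules for fast blocks or slow
blocks. -/
inductive ValidBlock {f : ℕ} {Tx : Type} (ok : Tx → Prop) : Block f Tx → Prop
  | genesis : ValidBlock ok Block.genesis
  | fast (p : Block f Tx) (batch : List Tx) (v : ℕ) (Q : QC f Tx)
      (hp : ValidBlock ok p) (htx : ∀ t ∈ batch, ok t) (hQ : ValidQC ok Q)
      (hQp : Q.block = p) (hv : Q.view + 1 = v) :
      ValidBlock ok (Block.fast (p.height + 1) p batch v Q (leader f v))
  | slow (p : Block f Tx) (batch : List Tx) (v : ℕ) (Q : QC f Tx) (S : List (NewView f Tx))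
      (π : List (Block f Tx))
      (hp : ValidBlock ok p) (htx : ∀ t ∈ batch, ok t) (hQ : ValidQC ok Q)
      (hS : ∀ m ∈ S, ValidNewView ok m) (hSv : ∀ m ∈ S, m.view = v)
      (hlen : S.length = quorum f) (hnodup : (S.map NewView.signer).Nodup)
      (hchoice : SlowChoice S p Q) (hπ : IsEvidence S π) :
      ValidBlock ok (Block.slow (p.height + 1) p batch v Q S π (leader f v))

/-- A valid certificate for `b` consists of votes by `n - f` distinct replicas for `b` or for
blocks that extend `b`. -/
inductive ValidQC {f : ℕ} {Tx : Type} (ok : Tx → Prop) : QC f Tx → Prop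
  | genesis : ValidQC ok QC.genesis
  | cert (b : Block f Tx) (σ : List (Vote f Tx)) (hb : ValidBlock ok b)
      (hσ : ∀ x ∈ σ, ValidVote ok x) (hext : ∀ x ∈ σ, Extends b x.block)
      (hlen : σ.length = quorum f) (hnodup : (σ.map Vote.signer).Nodup) :
      ValidQC ok (QC.cert b.view b σ)

inductive ValidVote {f : ℕ} {Tx : Type} (ok : Tx → Prop) : Vote f Tx → Prop
  | mk (b : Block f Tx) (r : Replica f) (hb : ValidBlock ok b) : ValidVote ok (Vote.mk b r)

/-- All components of a NEW-VIEW message are valid and older than the view to be started, and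
the vote in it is by its sender. -/
inductive ValidNewView {f : ℕ} {Tx : Type} (ok : Tx → Prop) : NewView f Tx → Prop
  | mk (v : ℕ) (Q : QC f Tx) (b : Block f Tx) (x : Option (Vote f Tx)) (r : Replica f)
      (hQ : ValidQC ok Q) (hb : ValidBlock ok b) (hx : ∀ y ∈ x, ValidVote ok y)
      (hQv : Q.view < v) (hbv : b.view < v) (hxv : ∀ y ∈ x, y.block.view < v)
      (hxr : ∀ y ∈ x, y.signer = r) :
      ValidNewView ok (NewView.mk v Q b x r)

end

/-! ### Messages -/

inductive Msg (f : ℕ) (Tx : Type) : Type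
  | voteReq (b : Block f Tx) : Msg f Tx
  | voteResp (x : Vote f Tx) : Msg f Tx
  | newView (m : NewView f Tx) : Msg f Tx

section Protocol

variable {f : ℕ} {Tx : Type}

def Msg.signer? : Msg f Tx → Option (Replica f)
  | .voteReq b => b.signer?
  | .voteResp x => some x.signer
  | .newView m => some m.signer

/-- `DirectPart m m'`: the message `m'` is an immediate component of the message `m`. -/
def DirectPart : Msg f Tx → Msg f Tx → Prop
  | .voteReq b, m' =>
      (∃ p, b.parent? = some p ∧ m' = .voteReq p) ∨ m' = .voteReq b.qc.block ∨
      (∃ x ∈ b.qc.votes, m' = .voteResp x) ∨ (∃ k ∈ b.newViews, m' = .newView k) ∨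
      (∃ c ∈ b.evidence, m' = .voteReq c)
  | .voteResp x, m' => m' = .voteReq x.block
  | .newView k, m' =>
      m' = .voteReq k.voteReq ∨ (∃ x ∈ k.voteResp, m' = .voteResp x) ∨
      m' = .voteReq k.qc.block ∨ (∃ x ∈ k.qc.votes, m' = .voteResp x)

/-- `Part m m'`: `m'` is `m` or occurs somewhere inside `m`. -/
def Part : Msg f Tx → Msg f Tx → Prop := Relation.ReflTransGen DirectPart

/-- The replicas exposed by the evidence in a VOTE-REQ: leaders who signed two different blocks
of one view. -/
def Msg.culprits : Msg f Tx → Set (Replica f)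
  | .voteReq b => {r | ∃ c ∈ b.evidence, ∃ d ∈ b.evidence, c ≠ d ∧ c.view = d.view ∧
      leader f c.view = r ∧ c.signer? = some r ∧ d.signer? = some r}
  | _ => ∅

/-! ### The local state and the event handlers of an honest replica -/

structure LocalState (f : ℕ) (Tx : Type) where
  /-- current view `v_r` -/
  view : ℕ
  /-- has a NEW-VIEW message for the current view been sent? -/
  joined : Prop
  /-- the certificate `QC_r` -/
  qc : QC f Tx
  /-- highest VOTE-REQ accepted `vr_r` -/
  voteReq : Block f Tx
  /-- highest VOTE-RESP sent `vp_r` -/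
  voteResp : Option (Vote f Tx)
  /-- the replicas known to have equivocated -/
  slashed : Set (Replica f)
  /-- the messages received -/
  inbox : Set (Msg f Tx)
  /-- the views in which this replica has made a proposal -/
  proposed : Set ℕ
  /-- the blocks committed -/
  committed : Set (Block f Tx)

def LocalState.start : LocalState f Tx where
  view := 1
  joined := False
  qc := .genesis
  voteReq := .genesis
  voteResp := none
  slashed := ∅
  inbox := ∅
  proposed := ∅
  committed := ∅

/-- The commit rule, applied on accepting the VOTE-REQ for `b`: the block `d` certified by the
certificate in the block that is certified by `b.qc` gets committed if the two certificates are
of consecutive views, or if no block on the chain from `b.qc.block` back to the view of `d`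
stores a VOTE-REQ of the same or a higher view than `d` that does not extend `d`. -/
def CommitRule (b d : Block f Tx) : Prop :=
  d = b.qc.block.qc.block ∧
    (d.view + 1 = b.qc.block.view ∨
      ∀ c, Extends c b.qc.block → d.view ≤ c.view → ∀ m ∈ c.newViews,
        d.view ≤ m.voteReq.view → Extends d m.voteReq)

/-- The replica in state `s` may accept and vote for the proposal `b`. -/
def CanVote (ok : Tx → Prop) (s : LocalState f Tx) (b : Block f Tx) : Prop :=
  Msg.voteReq b ∈ s.inbox ∧ b.view = s.view ∧ (∀ x ∈ s.voteResp, x.block.view < b.view) ∧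
    ValidBlock ok b

/-- The replica `r` in state `s` may, as leader of its current view, propose the block `b`:
either `n - f` votes for the block of the preceding view have arrived (fast view change), or
`n - f` NEW-VIEW messages for the current view have arrived (slow view change). -/
inductive CanPropose (ok : Tx → Prop) (r : Replica f) (s : LocalState f Tx) : Block f Tx → Prop
  | fast (p : Block f Tx) (batch : List Tx) (σ : List (Vote f Tx))
      (hr : r = leader f s.view) (hnew : s.view ∉ s.proposed) (htx : ∀ t ∈ batch, ok t)
      (hσ : ∀ x ∈ σ, Msg.voteResp x ∈ s.inbox ∧ ValidVote ok x ∧ x.block = p)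
      (hlen : σ.length = quorum f) (hnodup : (σ.map Vote.signer).Nodup)
      (hv : p.view + 1 = s.view) :
      CanPropose ok r s (Block.fast (p.height + 1) p batch s.view (QC.cert p.view p σ) r)
  | slow (p : Block f Tx) (Q : QC f Tx) (batch : List Tx) (S : List (NewView f Tx))
      (π : List (Block f Tx))
      (hr : r = leader f s.view) (hnew : s.view ∉ s.proposed) (htx : ∀ t ∈ batch, ok t)
      (hS : ∀ m ∈ S, Msg.newView m ∈ s.inbox ∧ ValidNewView ok m ∧ m.view = s.view)
      (hlen : S.length = quorum f) (hnodup : (S.map NewView.signer).Nodup)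
      (hchoice : SlowChoice S p Q) (hπ : IsEvidence S π) :
      CanPropose ok r s (Block.slow (p.height + 1) p batch s.view Q S π r)

/-- The NEW-VIEW message of replica `r` in state `s` for view `v`. -/
def LocalState.newViewMsg (s : LocalState f Tx) (r : Replica f) (v : ℕ) : NewView f Tx :=
  NewView.mk v s.qc s.voteReq s.voteResp r

/-- Reception of `m`: messages from slashed replicas are dropped; evidence leads to slashing. -/
def LocalState.afterReceive (s : LocalState f Tx) (m : Msg f Tx) : LocalState f Tx :=
  { s with
    inbox := s.inbox ∪ {m' | m' = m ∧ ∀ q ∈ m.signer?, q ∉ s.slashed}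
    slashed := s.slashed ∪ {p | p ∈ m.culprits ∧ ∀ q ∈ m.signer?, q ∉ s.slashed} }

/-- Replica `r` votes for `b`, applies the commit rule (committing a block commits its
ancestors), and enters the next view. -/
def LocalState.afterVote (s : LocalState f Tx) (r : Replica f) (b : Block f Tx) :
    LocalState f Tx :=
  { s with
    view := s.view + 1
    joined := False
    qc := b.qc
    voteReq := b
    voteResp := some (Vote.mk b r)
    committed := s.committed ∪ {c | ∃ d, CommitRule b d ∧ Extends c d} }

def LocalState.afterPropose (s : LocalState f Tx) : LocalState f Tx :=
  { s with proposed := s.proposed ∪ {s.view} }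

def LocalState.afterTimeout (s : LocalState f Tx) : LocalState f Tx :=
  { s with joined := True }

def LocalState.afterAdvance (s : LocalState f Tx) : LocalState f Tx :=
  { s with view := s.view + 1, joined := True }

/-! ### Executions -/

/-- One event of an execution.
* `timeout r`: `r` entered its current view `v` by voting in `v - 1`, and the timer set with that
  vote expires before a proposal for `v` was received; `r` sends a NEW-VIEW message for `v`.
* `advance r`: `r` gives up its current view `v`, enters `v + 1`, and sends a NEW-VIEW message
  for `v + 1`. When this happens is up to the pacemaker.
* `adversary p q m`: the faulty replica `p` sends `m` to `q`. -/
inductive Event (f : ℕ) (Tx : Type) : Type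
  | receive (r : Replica f) (m : Msg f Tx) : Event f Tx
  | vote (r : Replica f) (b : Block f Tx) : Event f Tx
  | propose (r : Replica f) (b : Block f Tx) : Event f Tx
  | timeout (r : Replica f) : Event f Tx
  | advance (r : Replica f) : Event f Tx
  | adversary (p q : Replica f) (m : Msg f Tx) : Event f Tx
  | idle : Event f Tx

/-- A timed sequence of events: `event i` happens at time `time i` and leads from `state i` to
`state (i + 1)`. The local states of faulty replicas have no meaning. -/
structure Execution (f : ℕ) (Tx : Type) where
  state : ℕ → Replica f → LocalState f Tx
  event : ℕ → Event f Tx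
  time : ℕ → ℝ

/-- The effect of an event on the local states. -/
def Event.next (e : Event f Tx) (s : Replica f → LocalState f Tx) :
    Replica f → LocalState f Tx :=
  match e with
  | .receive r m => Function.update s r ((s r).afterReceive m)
  | .vote r b => Function.update s r ((s r).afterVote r b)
  | .propose r _ => Function.update s r (s r).afterPropose
  | .timeout r => Function.update s r (s r).afterTimeout
  | .advance r => Function.update s r (s r).afterAdvance
  | .adversary _ _ _ => s
  | .idle => s

namespace Execution

/-- In event number `i`, replica `p` sends `m` to replica `q`. A proposal is sent to all
replicas, a vote and a NEW-VIEW message to the leader of the view that is to be entered. -/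
def Sends (E : Execution f Tx) (i : ℕ) (p q : Replica f) (m : Msg f Tx) : Prop :=
  match E.event i with
  | .vote r b => p = r ∧ q = leader f (b.view + 1) ∧ m = .voteResp (Vote.mk b r)
  | .propose r b => p = r ∧ m = .voteReq b
  | .timeout r => p = r ∧ q = leader f (E.state i r).view ∧
      m = .newView ((E.state i r).newViewMsg r (E.state i r).view)
  | .advance r => p = r ∧ q = leader f ((E.state i r).view + 1) ∧
      m = .newView ((E.state i r).newViewMsg r ((E.state i r).view + 1))
  | .adversary p' q' m' => p = p' ∧ q = q' ∧ m = m'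
  | _ => False

/-- Event number `i` is one that may happen. Honest replicas follow the protocol, with a timer of
length at least `τ`; only messages that were sent are received; and faulty replicas send
arbitrary messages, except that they cannot forge signatures of honest replicas. -/
def Legal (E : Execution f Tx) (ok : Tx → Prop) (Faulty : Finset (Replica f)) (τ : ℝ)
    (i : ℕ) : Prop :=
  match E.event i with
  | .receive r m => r ∉ Faulty ∧ ∃ j < i, ∃ p, E.Sends j p r m
  | .vote r b => r ∉ Faulty ∧ CanVote ok (E.state i r) b
  | .propose r b => r ∉ Faulty ∧ CanPropose ok r (E.state i r) b
  | .timeout r => r ∉ Faulty ∧ ¬ (E.state i r).joined ∧ (∀ b, ¬ CanVote ok (E.state i r) b) ∧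
      ∀ j < i, ∀ b, E.event j = .vote r b → b.view + 1 = (E.state i r).view →
        E.time j + τ ≤ E.time i
  | .advance r => r ∉ Faulty ∧ ∀ b, ¬ CanVote ok (E.state i r) b
  | .adversary p _ m => p ∈ Faulty ∧
      ∀ m', Part m m' → ∀ r ∈ m'.signer?, r ∉ Faulty → ∃ j < i, ∃ q, E.Sends j r q m'
  | .idle => True

/-- `E` is an execution of the protocol with faulty replicas `Faulty` and timers of length at
least `τ`. Time never decreases and grows without bound, and honest replicas compute in zero
time: no time passes while one of them can vote or propose. -/
structure FollowsProtocol (E : Execution f Tx) (ok : Tx → Prop) (Faulty : Finset (Replica f))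
    (τ : ℝ) : Prop where
  start : ∀ r, E.state 0 r = LocalState.start
  next : ∀ i, E.state (i + 1) = (E.event i).next (E.state i)
  legal : ∀ i, E.Legal ok Faulty τ i
  time_mono : Monotone E.time
  time_unbounded : Filter.Tendsto E.time Filter.atTop Filter.atTop
  prompt : ∀ i, ∀ r ∉ Faulty, ∀ b,
    (CanVote ok (E.state (i + 1) r) b ∨ CanPropose ok r (E.state (i + 1) r) b) →
      E.time (i + 1) = E.time i

/-- Messages between honest replicas arrive within `Δ` of the later of sending time and `GST`. -/
def PartiallySynchronous (E : Execution f Tx) (Faulty : Finset (Replica f)) (GST Δ : ℝ) : Prop :=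
  ∀ i, ∀ p ∉ Faulty, ∀ q ∉ Faulty, ∀ m, E.Sends i p q m →
    ∃ j > i, E.event j = .receive q m ∧ E.time j ≤ max (E.time i) GST + Δ

/-- View `v` is after `GST`: before `GST` no honest replica has reached it. -/
def AfterGST (E : Execution f Tx) (Faulty : Finset (Replica f)) (GST : ℝ) (v : ℕ) : Prop :=
  ∀ r ∉ Faulty, ∀ i, E.time i < GST → (E.state (i + 1) r).view < v

/-- Replica `r` enters view `v` in event number `i`. -/
def Enters (E : Execution f Tx) (r : Replica f) (v i : ℕ) : Prop :=
  (E.state i r).view < v ∧ (E.state (i + 1) r).view = v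

/-- The guarantees of the pacemaker (view synchronization). -/
structure Pacemaker (E : Execution f Tx) (Faulty : Finset (Replica f)) (GST Tf : ℝ) : Prop where
  /-- no honest replica stays in a view forever -/
  progress : ∀ r ∉ Faulty, ∀ i, ∃ j, (E.state i r).view < (E.state j r).view
  /-- after `GST`, all honest replicas enter a view with an honest leader within `Tf` of the
  first honest replica that enters it -/
  enter : ∀ v, E.AfterGST Faulty GST v → leader f v ∉ Faulty →
    ∀ r₀ ∉ Faulty, ∀ i, E.Enters r₀ v i →
      ∀ r ∉ Faulty, ∃ j, E.Enters r v j ∧ E.time j ≤ E.time i + Tf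
  /-- and receive a block proposed by its leader while they are in it -/
  receive : ∀ v, E.AfterGST Faulty GST v → leader f v ∉ Faulty →
    (∃ r₀ ∉ Faulty, ∃ i, E.Enters r₀ v i) →
      ∀ r ∉ Faulty, ∃ k b, (E.state k r).view = v ∧ Msg.voteReq b ∈ (E.state k r).inbox ∧
        b.view = v ∧ b.signer? = some (leader f v)

end Execution

end Protocol

end ChainedBFT

-- Among `3 f + 1` replicas in round-robin order, at most `f` of them faulty, three consecutive
-- views `w`, `w + 1`, `w + 2` beyond `v` have honest leaders (`exists_three_honest_leaders`). It
-- suffices that the proposals `b₀`, `b₁`, `b₂` of these leaders form a chain of certificates: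
-- consecutive views then satisfy the first alternative of the commit rule, and each honest replica
-- commits `b₀` on voting for `b₂`.
--
-- Votes: after GST the pacemaker delivers the honest leader's block while a replica is still in the
-- view, and a replica that can vote may not advance, so it votes (`exists_vote`). Unforgeable
-- signatures and one proposal per view make the block the same for everyone (`exists_proposal`).
--
-- Certificates: a fast block carries an honest vote of the preceding view, which can only be for
-- the honest leader's block there. A slow block would need a NEW-VIEW message from an honest
-- replica. That replica has entered the view by voting, so only its timer could have triggered the
-- message. But the honest votes are cast within `Tf` of each other and arrive `Δ` later, after
-- which the leader can propose at once, before any timer of length `τ > Tf + 2 Δ` expires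
-- (`propose_time`, `certified_block`).

namespace ChainedBFT

-- Validity of what an honest leader proposes

section Validity

variable {f : ℕ} {Tx : Type} {ok : Tx → Prop}

theorem quorum_pos (f : ℕ) : 0 < quorum f := by unfold quorum; omega

theorem ValidQC.block {Q : QC f Tx} (h : ValidQC ok Q) : ValidBlock ok Q.block := by
  cases h with
  | genesis => exact .genesis
  | cert b σ hb => exact hb

theorem ValidBlock.qc {b : Block f Tx} (h : ValidBlock ok b) : ValidQC ok b.qc := by
  cases h with
  | genesis => exact .genesis
  | fast => assumption
  | slow => assumption

theorem ValidBlock.parent {b p : Block f Tx} (h : ValidBlock ok b) (hp : b.parent? = some p) :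
    ValidBlock ok p := by
  cases h <;> simp only [Block.parent?, Option.some.injEq, reduceCtorEq] at hp <;>
    subst hp <;> assumption

theorem ValidBlock.of_extends {b c : Block f Tx} (h : ValidBlock ok c) (hbc : Extends b c) :
    ValidBlock ok b := by
  induction hbc with
  | refl => exact h
  | tail _ hp ih => exact ih (h.parent hp)

theorem ValidVote.block {x : Vote f Tx} (h : ValidVote ok x) : ValidBlock ok x.block := by
  cases h; assumption

theorem ValidBlock.signer {b : Block f Tx} (h : ValidBlock ok b) (hb : b.view ≠ 0) :
    b.signer? = some (leader f b.view) := by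
  cases h with
  | genesis => exact absurd rfl hb
  | fast => rfl
  | slow => rfl

/-- Induction principle for the parent and the certificate of a slow block. -/
theorem SlowChoice.invariant {S : List (NewView f Tx)} {p : Block f Tx} {Q : QC f Tx}
    (h : SlowChoice S p Q) {P : Block f Tx → Prop} {R : QC f Tx → Prop}
    (hreq : ∀ m ∈ S, P m.voteReq) (hqc : ∀ m ∈ S, R m.qc)
    (himplicit : ∀ Q, IsImplicitQC S Q → R Q) (hPR : ∀ b, P b → R b.qc)
    (hRP : ∀ Q, R Q → P Q.block) : P p ∧ R Q := by
  have hchoice : ∀ Q, IsChoiceQC S Q → R Q := by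
    rintro Q ⟨Q', ⟨hQ', _⟩, rfl | ⟨hQ, _⟩, _⟩
    · obtain ⟨m, hm, rfl⟩ := List.mem_map.1 hQ'
      exact hqc m hm
    · exact himplicit Q hQ
  have hhigh : ∀ (X : Block f Tx → Prop) b, IsHighVote S X b → P b := by
    rintro X b ⟨hb, _⟩
    obtain ⟨m, hm, rfl⟩ := List.mem_map.1 hb
    exact hreq m hm
  -- All four rules only recombine VOTE-REQs and certificates of `S`, the implicit certificate, and
  -- the two projections covered by `hPR` and `hRP`. Validity and authenticity are both instances.
  cases h with
  | extend b Q hQ hb => exact ⟨hhigh _ _ hb, hchoice _ hQ⟩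
  | ruledOut b Q hQ hb => exact ⟨hhigh _ _ hb, hPR _ (hhigh _ _ hb)⟩
  | keep b c Q hQ hb h hr hc => exact ⟨hhigh _ _ hc, hchoice _ hQ⟩
  | direct b Q hQ => exact ⟨hRP _ (hchoice _ hQ), hchoice _ hQ⟩

/-- An implicit certificate is for a block that some vote in `S` extends. -/
theorem IsImplicitQC.exists_vote {S : List (NewView f Tx)} {Q : QC f Tx} (h : IsImplicitQC S Q)
    (hS : S ≠ []) : ∃ m ∈ S, ∃ x ∈ m.voteResp, Extends Q.block x.block := by
  obtain ⟨b, σ, rfl, hmap, _, hext, _⟩ := h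
  obtain ⟨m, hm⟩ := List.exists_mem_of_ne_nil S hS
  have h1 : m.voteResp ∈ σ.map some := hmap ▸ List.mem_map_of_mem hm
  obtain ⟨x, hx, hxm⟩ := List.mem_map.1 h1
  exact ⟨m, hm, x, hxm.symm, hext x hx⟩

theorem IsImplicitQC.mem_voteResp {S : List (NewView f Tx)} {Q : QC f Tx}
    (h : IsImplicitQC S Q) {x : Vote f Tx} (hx : x ∈ Q.votes) : ∃ m ∈ S, x ∈ m.voteResp := by
  obtain ⟨b, σ, rfl, hmap, _, _, _⟩ := h
  have h1 : some x ∈ S.map NewView.voteResp := hmap ▸ List.mem_map_of_mem hx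
  obtain ⟨m, hm, hxm⟩ := List.mem_map.1 h1
  exact ⟨m, hm, hxm⟩

theorem ValidNewView.qc {m : NewView f Tx} (h : ValidNewView ok m) : ValidQC ok m.qc := by
  cases h; assumption

theorem ValidNewView.voteReq {m : NewView f Tx} (h : ValidNewView ok m) :
    ValidBlock ok m.voteReq := by
  cases h; assumption

theorem ValidNewView.voteResp {m : NewView f Tx} (h : ValidNewView ok m) {x : Vote f Tx}
    (hx : x ∈ m.voteResp) : ValidVote ok x ∧ x.signer = m.signer := by
  cases h with
  | mk v Q b y r hQ hb hy hQv hbv hyv hyr => exact ⟨hy x hx, hyr x hx⟩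

theorem IsImplicitQC.valid {S : List (NewView f Tx)} {Q : QC f Tx} (h : IsImplicitQC S Q)
    (hS : ∀ m ∈ S, ValidNewView ok m) (hlen : S.length = quorum f)
    (hnodup : (S.map NewView.signer).Nodup) : ValidQC ok Q := by
  have hne : S ≠ [] := List.ne_nil_of_length_pos (hlen ▸ quorum_pos f)
  obtain ⟨m, hm, x, hx, hext⟩ := h.exists_vote hne
  have hvotes : ∀ x ∈ Q.votes, ValidVote ok x := by
    intro x hx
    obtain ⟨m, hm, hxm⟩ := h.mem_voteResp hx
    exact ((hS m hm).voteResp hxm).1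
  have hb : ValidBlock ok Q.block := ((hS m hm).voteResp hx).1.block.of_extends hext
  obtain ⟨b, σ, rfl, hmap, _, hσ, _⟩ := h
  refine .cert b σ hb hvotes hσ ?_ ?_
  · have := congrArg List.length hmap
    simpa [hlen] using this.symm
  -- The votes inherit distinct signers from the messages, because the vote in a valid NEW-VIEW
  -- message is by its sender.
  · have h1 : (S.map NewView.signer).map some = (σ.map Vote.signer).map some := by
      have h2 : (S.map NewView.voteResp).map (Option.map Vote.signer) =
          (σ.map some).map (Option.map Vote.signer) := by rw [hmap]
      rw [List.map_map, List.map_map] at h2 ⊢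
      refine Eq.trans (List.map_congr_left fun m hm => ?_) h2
      have h3 : m.voteResp ∈ σ.map some := hmap ▸ List.mem_map_of_mem hm
      obtain ⟨x, _, hx⟩ := List.mem_map.1 h3
      simp only [Function.comp_apply, ← hx, Option.map_some]
      rw [((hS m hm).voteResp hx.symm).2]
    rwa [← List.map_injective_iff.2 (Option.some_injective _) h1]

theorem CanPropose.view {r : Replica f} {s : LocalState f Tx} {b : Block f Tx}
    (h : CanPropose ok r s b) : b.view = s.view := by cases h <;> rfl

theorem CanPropose.signer {r : Replica f} {s : LocalState f Tx} {b : Block f Tx}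
    (h : CanPropose ok r s b) : b.signer? = some r := by cases h <;> rfl

theorem CanPropose.notMem_proposed {r : Replica f} {s : LocalState f Tx} {b : Block f Tx}
    (h : CanPropose ok r s b) : s.view ∉ s.proposed := by cases h <;> assumption

/-- Needed so that honest replicas can vote for an honest leader's block: being formed by the rules
from valid messages already implies every clause of validity. -/
theorem CanPropose.valid {r : Replica f} {s : LocalState f Tx} {b : Block f Tx}
    (h : CanPropose ok r s b) : ValidBlock ok b := by
  cases h with
  | fast p batch σ hr hnew htx hσ hlen hnodup hv =>
    subst hr
    have hne : σ ≠ [] := List.ne_nil_of_length_pos (hlen ▸ quorum_pos f)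
    obtain ⟨x, hx⟩ := List.exists_mem_of_ne_nil σ hne
    have hp : ValidBlock ok p := (hσ x hx).2.2 ▸ (hσ x hx).2.1.block
    refine .fast p batch s.view _ hp htx ?_ rfl hv
    refine .cert p σ hp (fun x hx => (hσ x hx).2.1) (fun x hx => ?_) hlen hnodup
    rw [(hσ x hx).2.2]
    exact Relation.ReflTransGen.refl
  | slow p Q batch S π hr hnew htx hS hlen hnodup hchoice hπ =>
    subst hr
    have hSv : ∀ m ∈ S, ValidNewView ok m := fun m hm => (hS m hm).2.1
    obtain ⟨hp, hQ⟩ := hchoice.invariant (P := ValidBlock ok) (R := ValidQC ok)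
      (fun m hm => (hSv m hm).voteReq) (fun m hm => (hSv m hm).qc)
      (fun Q hQ => hQ.valid hSv hlen hnodup) (fun b hb => hb.qc) (fun Q hQ => hQ.block)
    exact .slow p batch s.view Q S π hp htx hQ hSv (fun m hm => (hS m hm).2.2) hlen hnodup
      hchoice hπ

end Validity

-- Local invariants of honest replicas

section Dynamics

variable {f : ℕ} {Tx : Type} {ok : Tx → Prop} {Faulty : Finset (Replica f)} {τ : ℝ}
  {E : Execution f Tx}

theorem Event.view_next (e : Event f Tx) (s : Replica f → LocalState f Tx) (r : Replica f) :
    (e.next s r).view = (s r).view ∨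
      ((e.next s r).view = (s r).view + 1 ∧ ((∃ b, e = .vote r b) ∨ e = .advance r)) := by
  cases e <;> simp only [Event.next, Function.update_apply, true_or] <;> split_ifs with h <;>
    simp [h, LocalState.afterReceive, LocalState.afterVote, LocalState.afterPropose,
      LocalState.afterTimeout, LocalState.afterAdvance]

theorem Event.mem_inbox_next (e : Event f Tx) (s : Replica f → LocalState f Tx) (r : Replica f)
    (m : Msg f Tx) : m ∈ (e.next s r).inbox ↔ m ∈ (s r).inbox ∨
      (e = .receive r m ∧ ∀ q ∈ m.signer?, q ∉ (s r).slashed) := by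
  cases e <;> simp only [Event.next, Function.update_apply] <;> (try split_ifs with h) <;>
    simp [LocalState.afterReceive, LocalState.afterVote, LocalState.afterPropose,
      LocalState.afterTimeout, LocalState.afterAdvance] <;> grind

theorem Event.mem_slashed_next (e : Event f Tx) (s : Replica f → LocalState f Tx)
    (r q : Replica f) (h : q ∈ (e.next s r).slashed) : q ∈ (s r).slashed ∨
      ∃ m, e = .receive r m ∧ q ∈ m.culprits := by
  cases e <;> simp only [Event.next, Function.update_apply] at h <;> (try split_ifs at h with h') <;>
    simp [LocalState.afterReceive, LocalState.afterVote, LocalState.afterPropose,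
      LocalState.afterTimeout, LocalState.afterAdvance] at h ⊢ <;> grind

theorem Event.mem_proposed_next (e : Event f Tx) (s : Replica f → LocalState f Tx)
    (r : Replica f) (w : ℕ) : w ∈ (e.next s r).proposed ↔ w ∈ (s r).proposed ∨
      ∃ b, e = .propose r b ∧ (s r).view = w := by
  cases e <;> simp only [Event.next, Function.update_apply] <;> (try split_ifs with h) <;>
    simp [LocalState.afterReceive, LocalState.afterVote, LocalState.afterPropose,
      LocalState.afterTimeout, LocalState.afterAdvance] <;> grind

/-- The part of the local state that is sent in NEW-VIEW messages changes only by voting. -/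
theorem Event.vote_next (e : Event f Tx) (s : Replica f → LocalState f Tx) (r : Replica f) :
    ((e.next s r).qc = (s r).qc ∧ (e.next s r).voteReq = (s r).voteReq ∧
        (e.next s r).voteResp = (s r).voteResp) ∨
      ∃ b, e = .vote r b ∧ (e.next s r).qc = b.qc ∧ (e.next s r).voteReq = b ∧
        (e.next s r).voteResp = some (Vote.mk b r) ∧ (e.next s r).view = (s r).view + 1 := by
  cases e <;> simp only [Event.next, Function.update_apply] <;> (try split_ifs with h) <;>
    simp [LocalState.afterReceive, LocalState.afterVote, LocalState.afterPropose,
      LocalState.afterTimeout, LocalState.afterAdvance] <;> grind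

namespace Execution.FollowsProtocol

variable (h : E.FollowsProtocol ok Faulty τ)
include h

theorem legal_vote {i : ℕ} {r : Replica f} {b : Block f Tx} (he : E.event i = .vote r b) :
    r ∉ Faulty ∧ CanVote ok (E.state i r) b := by
  have := h.legal i
  rwa [Execution.Legal, he] at this

theorem legal_propose {i : ℕ} {r : Replica f} {b : Block f Tx}
    (he : E.event i = .propose r b) : r ∉ Faulty ∧ CanPropose ok r (E.state i r) b := by
  have := h.legal i
  rwa [Execution.Legal, he] at this

theorem legal_receive {i : ℕ} {r : Replica f} {m : Msg f Tx} (he : E.event i = .receive r m) :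
    r ∉ Faulty ∧ ∃ j < i, ∃ p, E.Sends j p r m := by
  have := h.legal i
  rwa [Execution.Legal, he] at this

theorem legal_advance {i : ℕ} {r : Replica f} (he : E.event i = .advance r) :
    r ∉ Faulty ∧ ∀ b, ¬ CanVote ok (E.state i r) b := by
  have := h.legal i
  rwa [Execution.Legal, he] at this

theorem legal_timeout {i : ℕ} {r : Replica f} (he : E.event i = .timeout r) :
    r ∉ Faulty ∧ ¬ (E.state i r).joined ∧ (∀ b, ¬ CanVote ok (E.state i r) b) ∧
      ∀ j < i, ∀ b, E.event j = .vote r b → b.view + 1 = (E.state i r).view →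
        E.time j + τ ≤ E.time i := by
  have := h.legal i
  rwa [Execution.Legal, he] at this

theorem legal_adversary {i : ℕ} {p q : Replica f} {m : Msg f Tx}
    (he : E.event i = .adversary p q m) : p ∈ Faulty ∧
      ∀ m', Part m m' → ∀ r ∈ m'.signer?, r ∉ Faulty → ∃ j < i, ∃ q, E.Sends j r q m' := by
  have := h.legal i
  rwa [Execution.Legal, he] at this

theorem view_succ (i : ℕ) (r : Replica f) :
    (E.state (i + 1) r).view = (E.state i r).view ∨
      ((E.state (i + 1) r).view = (E.state i r).view + 1 ∧
        ((∃ b, E.event i = .vote r b) ∨ E.event i = .advance r)) := by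
  rw [h.next]
  exact Event.view_next _ _ _

theorem view_mono (r : Replica f) : Monotone fun i => (E.state i r).view :=
  monotone_nat_of_le_succ fun i => by rcases h.view_succ i r with h | h <;> omega

theorem inbox_mono (r : Replica f) : Monotone fun i => (E.state i r).inbox :=
  monotone_nat_of_le_succ fun i m hm => by
    rw [h.next, Event.mem_inbox_next]
    exact .inl hm

theorem exists_receive_of_mem_inbox {i : ℕ} {r : Replica f} {m : Msg f Tx}
    (hm : m ∈ (E.state i r).inbox) : ∃ j < i, E.event j = .receive r m := by
  induction i with
  | zero => rw [h.start] at hm; exact hm.elim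
  | succ i ih =>
    rw [h.next, Event.mem_inbox_next] at hm
    rcases hm with hm | hm
    · obtain ⟨j, hj, he⟩ := ih hm
      exact ⟨j, by omega, he⟩
    · exact ⟨i, by omega, hm.1⟩

theorem exists_sends_of_mem_inbox {i : ℕ} {r : Replica f} {m : Msg f Tx}
    (hm : m ∈ (E.state i r).inbox) : ∃ j < i, ∃ p, E.Sends j p r m := by
  obtain ⟨j, hj, he⟩ := h.exists_receive_of_mem_inbox hm
  obtain ⟨_, k, hk, p, hp⟩ := h.legal_receive he
  exact ⟨k, by omega, p, hp⟩

theorem mem_slashed {i : ℕ} {r q : Replica f} (hq : q ∈ (E.state i r).slashed) :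
    ∃ j < i, ∃ m, E.event j = .receive r m ∧ q ∈ m.culprits := by
  induction i with
  | zero => rw [h.start] at hq; exact hq.elim
  | succ i ih =>
    rw [h.next] at hq
    rcases Event.mem_slashed_next _ _ _ _ hq with hq | hq
    · obtain ⟨j, hj, he⟩ := ih hq
      exact ⟨j, by omega, he⟩
    · exact ⟨i, by omega, hq⟩

theorem mem_proposed {i : ℕ} {r : Replica f} {w : ℕ} : w ∈ (E.state i r).proposed ↔
    ∃ j < i, ∃ b, E.event j = .propose r b ∧ b.view = w := by
  induction i with
  | zero =>
    rw [h.start]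
    exact ⟨fun h => h.elim, fun ⟨j, hj, _⟩ => by omega⟩
  | succ i ih =>
    rw [h.next, Event.mem_proposed_next, ih]
    constructor
    · rintro (⟨j, hj, hb⟩ | ⟨b, hb, hw⟩)
      · exact ⟨j, by omega, hb⟩
      · exact ⟨i, by omega, b, hb, (h.legal_propose hb).2.view.trans hw⟩
    · rintro ⟨j, hj, b, hb, hw⟩
      rcases Nat.lt_succ_iff_lt_or_eq.1 hj with hj | rfl
      · exact .inl ⟨j, hj, b, hb, hw⟩
      · exact .inr ⟨b, hb, (h.legal_propose hb).2.view.symm.trans hw⟩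

/-- The latest vote of a replica. -/
theorem latest_vote (i : ℕ) (r : Replica f) :
    ((E.state i r).qc = .genesis ∧ (E.state i r).voteReq = .genesis ∧
        (E.state i r).voteResp = none) ∨
      ∃ j < i, ∃ b, E.event j = .vote r b ∧ (E.state i r).qc = b.qc ∧
        (E.state i r).voteReq = b ∧ (E.state i r).voteResp = some (Vote.mk b r) := by
  induction i with
  | zero => rw [h.start]; exact .inl ⟨rfl, rfl, rfl⟩
  | succ i ih =>
    rw [h.next]
    rcases Event.vote_next (E.event i) (E.state i) r with ⟨h1, h2, h3⟩ | ⟨b, hb, h1, h2, h3, _⟩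
    · rw [h1, h2, h3]
      rcases ih with ih | ⟨j, hj, ih⟩
      · exact .inl ih
      · exact .inr ⟨j, by omega, ih⟩
    · exact .inr ⟨i, by omega, b, hb, h1, h2, h3⟩

theorem view_after_vote {i : ℕ} {r : Replica f} {b : Block f Tx}
    (he : E.event i = .vote r b) :
    b.view = (E.state i r).view ∧ (E.state (i + 1) r).view = b.view + 1 := by
  have hv := (h.legal_vote he).2.2.1
  refine ⟨hv, ?_⟩
  rw [h.next, he, hv]
  simp [Event.next, LocalState.afterVote]

/-- Voting moves the replica past the view of the block, and views never decrease. Hence the clause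
of `CanVote` against voting twice never blocks a vote in the current view. -/
theorem voteResp_view_lt {i : ℕ} {r : Replica f} {x : Vote f Tx}
    (hx : x ∈ (E.state i r).voteResp) : x.block.view < (E.state i r).view := by
  rcases h.latest_vote i r with ⟨_, _, h3⟩ | ⟨j, hj, b, hb, _, _, h3⟩
  · rw [h3] at hx; exact absurd hx (by simp)
  · rw [h3] at hx
    obtain rfl : Vote.mk b r = x := by simpa using hx
    have h1 := h.view_mono r (show j + 1 ≤ i from hj)
    simp only [(h.view_after_vote hb).2] at h1
    exact h1

/-- The block of a proposal that an honest replica may make in a view is unique. -/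
theorem propose_unique {i j : ℕ} {r : Replica f} {b c : Block f Tx}
    (hb : E.event i = .propose r b) (hc : E.event j = .propose r c) (hv : b.view = c.view) :
    i = j ∧ b = c := by
  have key : ∀ {i j : ℕ} {b c : Block f Tx}, E.event i = .propose r b →
      E.event j = .propose r c → b.view = c.view → ¬ i < j := by
    intro i j b c hb hc hv hij
    have h1 := (h.legal_propose hc).2
    -- The earlier proposal has recorded its view in `proposed`, which bars the later one.
    exact h1.notMem_proposed (h.mem_proposed.2 ⟨i, hij, b, hb, hv.trans h1.view⟩)
  obtain rfl : i = j := le_antisymm (not_lt.1 (key hc hb hv.symm)) (not_lt.1 (key hb hc hv))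
  rw [hb] at hc
  exact ⟨rfl, by injection hc⟩

theorem sends_voteReq {i : ℕ} {r q : Replica f} {b : Block f Tx} (hr : r ∉ Faulty)
    (hs : E.Sends i r q (.voteReq b)) : E.event i = .propose r b := by
  unfold Execution.Sends at hs
  cases he : E.event i <;> simp [he] at hs
  · rw [hs.1, hs.2]
  · exact absurd (hs.1 ▸ (h.legal_adversary he).1) hr

theorem sends_voteResp {i : ℕ} {r q : Replica f} {x : Vote f Tx} (hr : r ∉ Faulty)
    (hs : E.Sends i r q (.voteResp x)) : E.event i = .vote r x.block ∧ x.signer = r := by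
  unfold Execution.Sends at hs
  cases he : E.event i <;> simp [he] at hs
  · obtain ⟨rfl, _, rfl⟩ := hs
    exact ⟨rfl, rfl⟩
  · exact absurd (hs.1 ▸ (h.legal_adversary he).1) hr

theorem sends_newView {i : ℕ} {r q : Replica f} {m : NewView f Tx} (hr : r ∉ Faulty)
    (hs : E.Sends i r q (.newView m)) :
    (E.event i = .timeout r ∧ m.view = (E.state i r).view) ∨
      (E.event i = .advance r ∧ m.view = (E.state i r).view + 1) := by
  unfold Execution.Sends at hs
  cases he : E.event i <;> simp [he] at hs
  · obtain ⟨rfl, _, rfl⟩ := hs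
    exact .inl ⟨rfl, rfl⟩
  · obtain ⟨rfl, _, rfl⟩ := hs
    exact .inr ⟨rfl, rfl⟩
  · exact absurd (hs.1 ▸ (h.legal_adversary he).1) hr

end Execution.FollowsProtocol

end Dynamics

end ChainedBFT
namespace ChainedBFT

-- Unforgeability of honest signatures

section Authenticity

variable {f : ℕ} {Tx : Type} {ok : Tx → Prop} {Faulty : Finset (Replica f)} {τ : ℝ}
  {E : Execution f Tx}

/-- All parts of `m` that bear the signature of an honest replica were sent by it before
event number `i`. -/
def Execution.Authentic (E : Execution f Tx) (Faulty : Finset (Replica f)) (i : ℕ)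
    (m : Msg f Tx) : Prop :=
  ∀ m', Part m m' → ∀ r ∈ m'.signer?, r ∉ Faulty → ∃ j < i, ∃ q, E.Sends j r q m'

/-- The block and the votes of the certificate `Q` are authentic. -/
def Execution.AuthenticQC (E : Execution f Tx) (Faulty : Finset (Replica f)) (i : ℕ)
    (Q : QC f Tx) : Prop :=
  E.Authentic Faulty i (.voteReq Q.block) ∧ ∀ x ∈ Q.votes, E.Authentic Faulty i (.voteResp x)

namespace Execution

theorem Authentic.part {i : ℕ} {m m' : Msg f Tx} (h : E.Authentic Faulty i m)
    (hm : Part m m') : E.Authentic Faulty i m' :=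
  fun k hk => h k (hm.trans hk)

theorem Authentic.directPart {i : ℕ} {m m' : Msg f Tx} (h : E.Authentic Faulty i m)
    (hm : DirectPart m m') : E.Authentic Faulty i m' :=
  h.part (.single hm)

theorem Authentic.mono {i j : ℕ} {m : Msg f Tx} (h : E.Authentic Faulty i m) (hij : i ≤ j) :
    E.Authentic Faulty j m := fun m' hm' r hr hF => by
  obtain ⟨k, hk, hs⟩ := h m' hm' r hr hF
  exact ⟨k, by omega, hs⟩

theorem authentic_of_directPart {i : ℕ} {m : Msg f Tx}
    (hm : ∀ r ∈ m.signer?, r ∉ Faulty → ∃ j < i, ∃ q, E.Sends j r q m)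
    (h : ∀ m', DirectPart m m' → E.Authentic Faulty i m') : E.Authentic Faulty i m := by
  intro m' hm'
  rcases hm'.cases_head with rfl | ⟨k, hk, hkm⟩
  · exact hm
  · exact h k hk m' hkm

/-- Genesis is a direct part of itself, through the block of its certificate, so unfolding its parts
does not terminate. But nothing else is ever reached, and genesis is unsigned. -/
theorem authentic_genesis (i : ℕ) : E.Authentic Faulty i (.voteReq .genesis) := by
  intro m' hm'
  have : m' = .voteReq .genesis := by
    induction hm' with
    | refl => rfl
    | tail _ hd ih =>
      subst ih
      simpa [DirectPart, Block.parent?, Block.qc, QC.block, QC.votes, Block.newViews,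
        Block.evidence] using hd
  subst this
  simp [Msg.signer?, Block.signer?]

theorem authenticQC_genesis (i : ℕ) : E.AuthenticQC Faulty i .genesis :=
  ⟨authentic_genesis i, fun x hx => by simp [QC.votes] at hx⟩

theorem Authentic.extends {i : ℕ} {b c : Block f Tx} (h : E.Authentic Faulty i (.voteReq c))
    (hbc : Extends b c) : E.Authentic Faulty i (.voteReq b) := by
  induction hbc with
  | refl => exact h
  | tail _ hp ih => exact ih (h.directPart (.inl ⟨_, hp, rfl⟩))

theorem Authentic.qc {i : ℕ} {b : Block f Tx} (h : E.Authentic Faulty i (.voteReq b)) :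
    E.AuthenticQC Faulty i b.qc :=
  ⟨h.directPart (.inr (.inl rfl)),
    fun x hx => h.directPart (.inr (.inr (.inl ⟨x, hx, rfl⟩)))⟩

theorem Authentic.newView_voteReq {i : ℕ} {m : NewView f Tx}
    (h : E.Authentic Faulty i (.newView m)) : E.Authentic Faulty i (.voteReq m.voteReq) :=
  h.directPart (.inl rfl)

theorem Authentic.newView_voteResp {i : ℕ} {m : NewView f Tx}
    (h : E.Authentic Faulty i (.newView m)) {x : Vote f Tx} (hx : x ∈ m.voteResp) :
    E.Authentic Faulty i (.voteResp x) :=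
  h.directPart (.inr (.inl ⟨x, hx, rfl⟩))

theorem Authentic.newView_qc {i : ℕ} {m : NewView f Tx}
    (h : E.Authentic Faulty i (.newView m)) : E.AuthenticQC Faulty i m.qc :=
  ⟨h.directPart (.inr (.inr (.inl rfl))),
    fun x hx => h.directPart (.inr (.inr (.inr ⟨x, hx, rfl⟩)))⟩

theorem Authentic.voteResp_block {i : ℕ} {x : Vote f Tx}
    (h : E.Authentic Faulty i (.voteResp x)) : E.Authentic Faulty i (.voteReq x.block) :=
  h.directPart rfl

/-- A proposal formed from authentic messages has authentic parts. -/
theorem authentic_of_canPropose {i : ℕ} {r : Replica f} {s : LocalState f Tx} {b : Block f Tx}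
    (h : CanPropose ok r s b) (hs : ∀ m ∈ s.inbox, E.Authentic Faulty i m) :
    ∀ m', DirectPart (.voteReq b) m' → E.Authentic Faulty i m' := by
  cases h with
  | fast p batch σ hr hnew htx hσ hlen hnodup hv =>
    obtain ⟨x, hx⟩ := List.exists_mem_of_ne_nil σ
      (List.ne_nil_of_length_pos (hlen ▸ quorum_pos f))
    have hp : E.Authentic Faulty i (.voteReq p) :=
      (hσ x hx).2.2 ▸ (hs _ (hσ x hx).1).voteResp_block
    rintro m' (⟨q, hq, rfl⟩ | rfl | ⟨y, hy, rfl⟩ | ⟨k, hk, rfl⟩ | ⟨c, hc, rfl⟩)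
    · obtain rfl : p = q := by simpa [Block.parent?] using hq
      exact hp
    · exact hp
    · exact hs _ (hσ y hy).1
    · simp [Block.newViews] at hk
    · simp [Block.evidence] at hc
  | slow p Q batch S π hr hnew htx hS hlen hnodup hchoice hπ =>
    have hS' : ∀ m ∈ S, E.Authentic Faulty i (.newView m) := fun m hm => hs _ (hS m hm).1
    have hne : S ≠ [] := List.ne_nil_of_length_pos (hlen ▸ quorum_pos f)
    obtain ⟨hp, hQ⟩ := hchoice.invariant (P := fun b => E.Authentic Faulty i (.voteReq b))
      (R := E.AuthenticQC Faulty i) (fun m hm => (hS' m hm).newView_voteReq)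
      (fun m hm => (hS' m hm).newView_qc)
      (fun Q hQ => ⟨by
        obtain ⟨m, hm, x, hx, hext⟩ := hQ.exists_vote hne
        exact ((hS' m hm).newView_voteResp hx).voteResp_block.extends hext, fun x hx => by
        obtain ⟨m, hm, hx⟩ := hQ.mem_voteResp hx
        exact (hS' m hm).newView_voteResp hx⟩)
      (fun b hb => hb.qc) (fun Q hQ => hQ.1)
    rintro m' (⟨q, hq, rfl⟩ | rfl | ⟨y, hy, rfl⟩ | ⟨k, hk, rfl⟩ | ⟨c, hc, rfl⟩)
    · obtain rfl : p = q := by simpa [Block.parent?] using hq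
      exact hp
    · exact hQ.1
    · exact hQ.2 y hy
    · exact hS' k hk
    · obtain ⟨m, hm, rfl⟩ := List.mem_map.1 ((hπ c).1 hc).1
      exact (hS' m hm).newView_voteReq

namespace FollowsProtocol

variable (h : E.FollowsProtocol ok Faulty τ)
include h

/-- Signatures of honest replicas cannot be forged. -/
theorem authentic_of_sends {j : ℕ} {p q : Replica f} {m : Msg f Tx} (hs : E.Sends j p q m) :
    E.Authentic Faulty (j + 1) m := by
  induction j using Nat.strong_induction_on generalizing p q m with
  | _ j ih =>
  -- A message in an inbox by state `j` was sent in an event before `j`, so the induction hypothesis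
  -- covers it.
  have hinbox : ∀ i ≤ j, ∀ r, ∀ m ∈ (E.state i r).inbox, E.Authentic Faulty (j + 1) m := by
    intro i hi r m hm
    obtain ⟨k, hk, p, hp⟩ := h.exists_sends_of_mem_inbox hm
    exact (ih k (by omega) hp).mono (by omega)
  have hvote : ∀ i ≤ j, ∀ r b, E.event i = .vote r b →
      E.Authentic Faulty (j + 1) (.voteResp (.mk b r)) := by
    intro i hi r b he
    refine authentic_of_directPart ?_ ?_
    · intro r' hr' _
      obtain rfl : r = r' := by simpa [Msg.signer?, Vote.signer] using hr'
      exact ⟨i, by omega, leader f (b.view + 1), by simp [Execution.Sends, he]⟩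
    · rintro m' rfl
      exact hinbox i hi r _ (h.legal_vote he).2.1
  have hnewView : ∀ r w, (∃ q, E.Sends j r q (.newView ((E.state j r).newViewMsg r w))) →
      E.Authentic Faulty (j + 1) (.newView ((E.state j r).newViewMsg r w)) := by
    intro r w hs
    refine authentic_of_directPart ?_ ?_
    · intro r' hr' _
      obtain rfl : r = r' := by
        simpa [Msg.signer?, NewView.signer, LocalState.newViewMsg] using hr'
      exact ⟨j, by omega, hs⟩
    -- The contents of a NEW-VIEW message are either the initial values or come from the sender's
    -- latest vote, which was authentic when cast.
    · have key : E.Authentic Faulty (j + 1) (.voteReq (E.state j r).voteReq) ∧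
          (∀ x ∈ (E.state j r).voteResp, E.Authentic Faulty (j + 1) (.voteResp x)) ∧
          E.AuthenticQC Faulty (j + 1) (E.state j r).qc := by
        rcases h.latest_vote j r with ⟨h1, h2, h3⟩ | ⟨i, hi, b, he, h1, h2, h3⟩
        · rw [h1, h2, h3]
          exact ⟨authentic_genesis _, by simp, authenticQC_genesis _⟩
        · rw [h1, h2, h3]
          have hb := hvote i hi.le r b he
          exact ⟨hb.voteResp_block, fun x hx => by
            obtain rfl : Vote.mk b r = x := by simpa using hx
            exact hb, hb.voteResp_block.qc⟩
      rintro m' (rfl | ⟨x, hx, rfl⟩ | rfl | ⟨x, hx, rfl⟩)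
      · exact key.1
      · exact key.2.1 x hx
      · exact key.2.2.1
      · exact key.2.2.2 x hx
  have hs' := hs
  unfold Execution.Sends at hs
  cases he : E.event j <;> simp [he] at hs
  · obtain ⟨rfl, _, rfl⟩ := hs
    exact hvote j le_rfl _ _ he
  · obtain ⟨rfl, rfl⟩ := hs
    have hc := (h.legal_propose he).2
    refine authentic_of_directPart ?_ (authentic_of_canPropose hc (hinbox j le_rfl _))
    intro r' hr' _
    obtain rfl : p = r' := by simpa [Msg.signer?, hc.signer] using hr'
    exact ⟨j, by omega, q, hs'⟩
  · obtain ⟨rfl, _, rfl⟩ := hs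
    exact hnewView _ _ ⟨q, hs'⟩
  · obtain ⟨rfl, _, rfl⟩ := hs
    exact hnewView _ _ ⟨q, hs'⟩
  · obtain ⟨rfl, _, rfl⟩ := hs
    exact Authentic.mono (h.legal_adversary he).2 (Nat.le_succ j)

theorem authentic_of_mem_inbox {i : ℕ} {r : Replica f} {m : Msg f Tx}
    (hm : m ∈ (E.state i r).inbox) : E.Authentic Faulty i m := by
  obtain ⟨j, hj, p, hs⟩ := h.exists_sends_of_mem_inbox hm
  exact (h.authentic_of_sends hs).mono hj

/-- An honest replica that signed a received message has sent it. -/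
theorem sends_of_mem_inbox {i : ℕ} {r p : Replica f} {m : Msg f Tx}
    (hm : m ∈ (E.state i r).inbox) (hp : m.signer? = some p) (hF : p ∉ Faulty) :
    ∃ j < i, ∃ q, E.Sends j p q m :=
  h.authentic_of_mem_inbox hm m .refl p (by simp [hp]) hF

/-- Honest replicas are never exposed as equivocators. -/
theorem notMem_slashed {i : ℕ} {r p : Replica f} (hp : p ∉ Faulty) :
    p ∉ (E.state i r).slashed := by
  intro hs
  obtain ⟨j, _, m, he, hm⟩ := h.mem_slashed hs
  obtain ⟨_, k, _, q, hk⟩ := h.legal_receive he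
  have hauth := h.authentic_of_sends hk
  cases m with
  | voteReq b =>
    -- Evidence against `p` would be two different blocks of one view signed by `p`. By authenticity
    -- the honest `p` proposed both, against `propose_unique`.
    obtain ⟨c, hc, d, hd, hne, hv, _, hcp, hdp⟩ := hm
    have key : ∀ c ∈ b.evidence, c.signer? = some p → ∃ i, E.event i = .propose p c := by
      intro c hc hcp
      have hpart : DirectPart (.voteReq b) (.voteReq c) :=
        .inr (.inr (.inr (.inr ⟨c, hc, rfl⟩)))
      obtain ⟨i, _, q, hs⟩ := hauth _ (.single hpart) p (by simp [Msg.signer?, hcp]) hp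
      exact ⟨i, h.sends_voteReq hp hs⟩
    obtain ⟨i, hi⟩ := key c hc hcp
    obtain ⟨i', hi'⟩ := key d hd hdp
    exact hne (h.propose_unique hi hi' hv).2
  | voteResp x => exact hm
  | newView x => exact hm

/-- Reception drops only messages from slashed signers, and honest signers are never slashed. -/
theorem mem_inbox_of_receive {j : ℕ} {r p : Replica f} {m : Msg f Tx}
    (he : E.event j = .receive r m) (hm : m.signer? = some p) (hp : p ∉ Faulty) :
    m ∈ (E.state (j + 1) r).inbox := by
  rw [h.next, Event.mem_inbox_next]
  refine .inr ⟨he, fun q hq => ?_⟩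
  obtain rfl : p = q := by simpa [hm] using hq
  exact h.notMem_slashed hp

end FollowsProtocol

end Execution

end Authenticity

end ChainedBFT
namespace ChainedBFT

-- Quorums and leader rotation

section Counting

variable {f : ℕ} {Faulty : Finset (Replica f)}

theorem exists_honest_of_quorum (hFaulty : Faulty.card ≤ f) {l : List (Replica f)}
    (hl : l.Nodup) (hlen : l.length = quorum f) : ∃ r ∈ l, r ∉ Faulty := by
  by_contra! hall
  have h1 : l.toFinset ⊆ Faulty := fun r hr => hall r (List.mem_toFinset.1 hr)
  have h2 := Finset.card_le_card h1
  rw [List.toFinset_card_of_nodup hl, hlen, quorum] at h2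
  omega

theorem exists_honest_quorum (hFaulty : Faulty.card ≤ f) :
    ∃ l : List (Replica f), l.Nodup ∧ l.length = quorum f ∧ ∀ r ∈ l, r ∉ Faulty := by
  have hcard : quorum f ≤ (Faultyᶜ).card := by
    rw [Finset.card_compl, Fintype.card_fin, quorum]
    omega
  obtain ⟨T, hT, hTc⟩ := Finset.exists_subset_card_eq hcard
  refine ⟨T.toList, T.nodup_toList, by rw [Finset.length_toList, hTc], fun r hr => ?_⟩
  exact Finset.mem_compl.1 (hT (Finset.mem_toList.1 hr))

/-- In a window of `3 f + 1` consecutive views each replica leads only once. -/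
theorem card_filter_leader_le (Faulty : Finset (Replica f)) (a : ℕ) :
    ((Finset.range (3 * f + 1)).filter fun u => leader f (a + u) ∈ Faulty).card ≤
      Faulty.card := by
  refine Finset.card_le_card_of_injOn (fun u => leader f (a + u))
    (fun u hu => (Finset.mem_filter.1 hu).2) fun u hu u' hu' huu => ?_
  have h1 : a + u ≡ a + u' [MOD 3 * f + 1] := congrArg Fin.val huu
  exact Nat.ModEq.eq_of_lt_of_lt (Nat.ModEq.add_left_cancel' a h1)
    (Finset.mem_range.1 (Finset.mem_filter.1 hu).1)
    (Finset.mem_range.1 (Finset.mem_filter.1 hu').1)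

/-- Round-robin rotation makes three honest replicas leaders of consecutive views. -/
theorem exists_three_honest_leaders (hFaulty : Faulty.card ≤ f) (a : ℕ) :
    ∃ w ≥ a, leader f w ∉ Faulty ∧ leader f (w + 1) ∉ Faulty ∧ leader f (w + 2) ∉ Faulty := by
  by_contra! hall
  -- `bad k` collects the starting points `a + u` spoiled by a faulty leader `k` views later. Three
  -- such sets of size at most `f` cannot cover `3 f + 1` starting points.
  let bad : ℕ → Finset ℕ := fun k =>
    (Finset.range (3 * f + 1)).filter fun u => leader f (a + k + u) ∈ Faulty
  have hcover : Finset.range (3 * f + 1) ⊆ bad 0 ∪ (bad 1 ∪ bad 2) := by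
    intro u hu
    simp only [bad, Finset.mem_union, Finset.mem_filter, hu, true_and]
    by_contra! hne
    refine hne.2.2 ?_
    have := hall (a + u) (by omega) (by simpa using hne.1)
    rw [show a + 2 + u = a + u + 2 by omega]
    exact this (by simpa only [show a + 1 + u = a + u + 1 by omega] using hne.2.1)
  have h0 := (Finset.card_le_card hcover).trans (Finset.card_union_le _ _)
  have h1 := Finset.card_union_le (bad 1) (bad 2)
  have hbad : ∀ k, (bad k).card ≤ f := fun k => (card_filter_leader_le Faulty (a + k)).trans hFaulty
  have := hbad 0
  have := hbad 1
  have := hbad 2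
  rw [Finset.card_range] at h0
  omega

end Counting

-- Progress after GST

section Liveness

variable {f : ℕ} {Tx : Type} {ok : Tx → Prop} {Faulty : Finset (Replica f)} {GST Δ Tf τ : ℝ}
  {E : Execution f Tx}

namespace Execution

theorem AfterGST.mono {v w : ℕ} (h : E.AfterGST Faulty GST v) (hvw : v ≤ w) :
    E.AfterGST Faulty GST w := fun r hr i hi => (h r hr i hi).trans_le hvw

namespace FollowsProtocol

variable (h : E.FollowsProtocol ok Faulty τ)
include h

/-- This identifies the event in which the pacemaker says a view is entered with the vote that led
into it, and excludes entering one view both by voting and by advancing. -/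
theorem enters_unique {r : Replica f} {w i j : ℕ} (hi : E.Enters r w i) (hj : E.Enters r w j) :
    i = j := by
  have key : ∀ {i j}, E.Enters r w i → E.Enters r w j → ¬ i < j := by
    intro i j hi hj hij
    have h1 := h.view_mono r (show i + 1 ≤ j from hij)
    simp only [hi.2] at h1
    exact absurd hj.1 (by omega)
  exact le_antisymm (not_lt.1 (key hj hi)) (not_lt.1 (key hi hj))

theorem enters_of_vote {i : ℕ} {r : Replica f} {b : Block f Tx} (he : E.event i = .vote r b) :
    E.Enters r (b.view + 1) i := by
  obtain ⟨h1, h2⟩ := h.view_after_vote he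
  exact ⟨by omega, h2⟩

theorem enters_of_advance {i : ℕ} {r : Replica f} (he : E.event i = .advance r) :
    E.Enters r ((E.state i r).view + 1) i := by
  refine ⟨by omega, ?_⟩
  rw [h.next, he]
  simp [Event.next, LocalState.afterAdvance]

theorem view_of_enters {r : Replica f} {w i : ℕ} (hi : E.Enters r (w + 1) i) :
    (E.state i r).view = w ∧ ((∃ b, E.event i = .vote r b) ∨ E.event i = .advance r) := by
  obtain ⟨h1, h2⟩ := hi
  rcases h.view_succ i r with h3 | ⟨h3, h4⟩
  · omega
  · exact ⟨by omega, h4⟩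

/-- Every honest replica enters every view. -/
theorem exists_enters (hp : E.Pacemaker Faulty GST Tf) {r : Replica f} (hr : r ∉ Faulty)
    {w : ℕ} (hw : 2 ≤ w) : ∃ i, E.Enters r w i := by
  classical
  have hex : ∀ w, ∃ j, w ≤ (E.state j r).view := by
    intro w
    induction w with
    | zero => exact ⟨0, Nat.zero_le _⟩
    | succ w ih =>
      obtain ⟨i, hi⟩ := ih
      obtain ⟨j, hj⟩ := hp.progress r hr i
      exact ⟨j, by omega⟩
  have hspec := Nat.find_spec (hex w)
  have hmin := fun {m} => Nat.find_min (hex w) (m := m)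
  rcases hn : Nat.find (hex w) with _ | i
  -- Replicas start in view `1`, which is therefore never entered; this is where `2 ≤ w` is used.
  · rw [hn, h.start] at hspec
    exact absurd hspec (by simp only [LocalState.start]; omega)
  · rw [hn] at hspec hmin
    have h1 := hmin (Nat.lt_succ_self i)
    refine ⟨i, by omega, ?_⟩
    rcases h.view_succ i r with h2 | ⟨h2, _⟩ <;> omega

/-- Honest replicas vote only for what an honest leader has proposed. -/
theorem exists_propose_of_vote {e : ℕ} {r : Replica f} {b : Block f Tx}
    (he : E.event e = .vote r b) (hb : b.view ≠ 0) (hl : leader f b.view ∉ Faulty) :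
    ∃ i, E.event i = .propose (leader f b.view) b := by
  obtain ⟨hin, _, _, hvalid⟩ := (h.legal_vote he).2
  obtain ⟨i, _, q, hs⟩ := h.sends_of_mem_inbox hin (hvalid.signer hb) hl
  exact ⟨i, h.sends_voteReq hl hs⟩

/-- After `GST`, the honest replicas vote in every view with an honest leader. -/
theorem exists_vote (hp : E.Pacemaker Faulty GST Tf) {w : ℕ} (hw : 2 ≤ w)
    (hGST : E.AfterGST Faulty GST w) (hl : leader f w ∉ Faulty) {r : Replica f}
    (hr : r ∉ Faulty) : ∃ e b, E.event e = .vote r b ∧ b.view = w := by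
  obtain ⟨k, b, hk, hin, hbv, hbs⟩ :=
    hp.receive w hGST hl ⟨r, hr, h.exists_enters hp hr hw⟩ r hr
  obtain ⟨e, he⟩ := h.exists_enters hp hr (show 2 ≤ w + 1 by omega)
  obtain ⟨hev, ⟨c, hc⟩ | hadv⟩ := h.view_of_enters he
  · exact ⟨e, c, hc, (h.view_after_vote hc).1.trans hev⟩
  · refine absurd ?_ ((h.legal_advance hadv).2 b)
    -- At `k` the replica is still in view `w`, which it leaves in event `e`. So the block is
    -- already in the inbox when it would advance.
    have hke : k ≤ e := by
      by_contra! hek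
      have h1 := h.view_mono r (show e + 1 ≤ k from hek)
      simp only [he.2, hk] at h1
      omega
    obtain ⟨i, _, q, hs⟩ := h.sends_of_mem_inbox hin hbs hl
    refine ⟨h.inbox_mono r hke hin, hbv.trans hev.symm, fun x hx => ?_,
      (h.legal_propose (h.sends_voteReq hl hs)).2.valid⟩
    rw [hbv, ← hev]
    exact h.voteResp_view_lt hx

/-- After `GST`, all honest replicas vote for the one block that an honest leader proposes. -/
theorem exists_proposal (hp : E.Pacemaker Faulty GST Tf) {w : ℕ} (hw : 2 ≤ w)
    (hGST : E.AfterGST Faulty GST w) (hl : leader f w ∉ Faulty) :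
    ∃ b i, E.event i = .propose (leader f w) b ∧ b.view = w ∧
      ∀ r ∉ Faulty, ∃ e, E.event e = .vote r b := by
  obtain ⟨e, b, he, rfl⟩ := h.exists_vote hp hw hGST hl hl
  obtain ⟨i, hi⟩ := h.exists_propose_of_vote he (by omega) hl
  refine ⟨b, i, hi, rfl, fun r hr => ?_⟩
  obtain ⟨e', c, he', hc⟩ := h.exists_vote hp hw hGST hl hr
  obtain ⟨j, hj⟩ := h.exists_propose_of_vote he' (by omega) (hc ▸ hl)
  rw [hc] at hj
  obtain rfl := (h.propose_unique hi hj hc.symm).2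
  exact ⟨e', he'⟩

/-- If all honest replicas vote for `b` after `GST` and the leader of the next view is honest, then
it makes its proposal before the timer of any honest replica that voted for `b` can expire. -/
theorem propose_time (hFaulty : Faulty.card ≤ f) (hτ : Tf + 2 * Δ < τ)
    (hn : E.PartiallySynchronous Faulty GST Δ) (hp : E.Pacemaker Faulty GST Tf)
    {b b' : Block f Tx} {i : ℕ} (hGST : E.AfterGST Faulty GST b.view)
    (hvote : ∀ r ∉ Faulty, ∃ e, E.event e = .vote r b)
    (hi : E.event i = .propose (leader f (b.view + 1)) b') (hb' : b'.view = b.view + 1)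
    {r : Replica f} {e : ℕ} (he : E.event e = .vote r b) : E.time i < E.time e + τ := by
  obtain ⟨hl, hpropose⟩ := h.legal_propose hi
  generalize hL : leader f (b.view + 1) = L at *
  -- Faulty replicas get a dummy index, so that `choose` yields a total function.
  have hvote' : ∀ r, ∃ e, r ∉ Faulty → E.event e = .vote r b := by
    intro r
    by_cases hr : r ∈ Faulty
    · exact ⟨0, fun hr' => absurd hr hr'⟩
    · obtain ⟨e, he⟩ := hvote r hr
      exact ⟨e, fun _ => he⟩
  choose vt hvt using hvote'
  have hne : (Faultyᶜ).Nonempty := ⟨L, Finset.mem_compl.2 hl⟩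
  -- The first honest voter, by event number; monotonicity turns this into the earliest time.
  obtain ⟨r₀, hr₀, hmin⟩ := Finset.exists_min_image Faultyᶜ vt hne
  rw [Finset.mem_compl] at hr₀
  have hvt_time : ∀ r ∉ Faulty, E.time (vt r) ≤ E.time (vt r₀) + Tf := by
    intro r hr
    obtain ⟨j, hj, hjt⟩ := hp.enter (b.view + 1) (hGST.mono (Nat.le_succ _)) (hL ▸ hl) r₀ hr₀ _
      (h.enters_of_vote (hvt r₀ hr₀)) r hr
    rwa [h.enters_unique (h.enters_of_vote (hvt r hr)) hj]
  have hrecv : ∀ r, ∃ k, r ∉ Faulty → vt r < k ∧ E.event k = .receive L (.voteResp (.mk b r)) ∧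
      E.time k ≤ E.time (vt r) + Δ := by
    intro r
    by_cases hr : r ∈ Faulty
    · exact ⟨0, fun hr' => absurd hr hr'⟩
    · have hs : E.Sends (vt r) r L (.voteResp (.mk b r)) := by
        simp [Execution.Sends, hvt r hr, hL]
      obtain ⟨k, hk, hke, hkt⟩ := hn _ r hr L hl _ hs
      -- The vote leads into a view that no honest replica reaches before GST, so the delay `Δ`
      -- counts from the vote itself.
      have hG : GST ≤ E.time (vt r) := by
        by_contra! hlt
        have h1 := hGST r hr _ hlt
        rw [(h.view_after_vote (hvt r hr)).2] at h1
        omega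
      rw [max_eq_left hG] at hkt
      exact ⟨k, fun _ => ⟨hk, hke, hkt⟩⟩
  choose rc hrc using hrecv
  have hΔ : 0 ≤ Δ := by
    obtain ⟨h1, _, h2⟩ := hrc r₀ hr₀
    have := h.time_mono h1.le
    linarith
  obtain ⟨r₁, hr₁, hmax⟩ := Finset.exists_max_image Faultyᶜ rc hne
  rw [Finset.mem_compl] at hr₁
  -- After event `K` the leader holds the votes of all honest replicas, its own included.
  set K := rc r₁ with hK
  have hKt : E.time K ≤ E.time (vt r₀) + Tf + Δ := by
    have h1 := (hrc r₁ hr₁).2.2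
    have h2 := hvt_time r₁ hr₁
    linarith
  obtain ⟨l, hlnd, hllen, hlF⟩ := exists_honest_quorum hFaulty
  -- From `K` until its actual proposal the leader stays in view `b.view + 1` without having
  -- proposed there. A fast block with empty batch, certified by an honest quorum, is thus available
  -- throughout.
  have hcan : ∀ j, K < j → j ≤ i → ∃ c, CanPropose ok L (E.state j L) c := by
    intro j hKj hji
    have hview : (E.state j L).view = b.view + 1 := by
      have h1 := h.view_mono L hji
      have h2 := h.view_mono L (show vt L + 1 ≤ j by
        have := hmax L (Finset.mem_compl.2 hl)
        have := (hrc L hl).1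
        omega)
      simp only [← hpropose.view, (h.view_after_vote (hvt L hl)).2, hb'] at h1 h2
      omega
    have hnew : (E.state j L).view ∉ (E.state j L).proposed := by
      rw [hview]
      intro hmem
      obtain ⟨k, hk, c, hc, hcv⟩ := h.mem_proposed.1 hmem
      have := (h.propose_unique hc hi (hcv.trans hb'.symm)).1
      omega
    refine ⟨_, CanPropose.fast b [] (l.map fun r => Vote.mk b r) (by rw [hview, hL]) hnew
      (by simp) ?_ (by simpa using hllen) ?_ hview.symm⟩
    · intro x hx
      obtain ⟨r, hr, rfl⟩ := List.mem_map.1 hx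
      have hrF := hlF r hr
      refine ⟨h.inbox_mono L (show rc r + 1 ≤ j by
        have := hmax r (Finset.mem_compl.2 hrF)
        omega) (h.mem_inbox_of_receive (p := r) (hrc r hrF).2.1 rfl hrF), ?_, rfl⟩
      exact .mk b r (h.legal_vote (hvt r hrF)).2.2.2.2
    · rw [List.map_map]
      have : Vote.signer ∘ (fun r => Vote.mk b r) = (id : Replica f → Replica f) := rfl
      rwa [this, List.map_id]
  have htime : ∀ j, K ≤ j → j ≤ i → E.time j ≤ E.time (vt r₀) + Tf + Δ := by
    intro j hKj
    induction j, hKj using Nat.le_induction with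
    | base => exact fun _ => hKt
    | succ j hKj ih =>
      intro hji
      obtain ⟨c, hc⟩ := hcan (j + 1) (by omega) hji
      -- While the leader can propose, no time passes.
      rw [h.prompt j L hl c (.inr hc)]
      exact ih (by omega)
  have hit : E.time i ≤ E.time (vt r₀) + Tf + Δ := by
    rcases le_total K i with hKi | hiK
    · exact htime i hKi le_rfl
    · exact (h.time_mono hiK).trans hKt
  have hr := (h.legal_vote he).1
  have h1 : vt r = e :=
    h.enters_unique (h.enters_of_vote (hvt r hr)) (h.enters_of_vote he)
  have h2 := h.time_mono (hmin r (Finset.mem_compl.2 hr))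
  rw [h1] at h2
  -- The bound `Tf + Δ` is below `τ` because `0 ≤ Δ`.
  linarith

/-- Of two consecutive honest leaders after `GST`, the second extends the block of the first
by a fast view change. -/
theorem certified_block (hFaulty : Faulty.card ≤ f) (hτ : Tf + 2 * Δ < τ)
    (hn : E.PartiallySynchronous Faulty GST Δ) (hp : E.Pacemaker Faulty GST Tf)
    {b b' : Block f Tx} {i j : ℕ} (hGST : E.AfterGST Faulty GST b.view)
    (hb : b.view ≠ 0) (hvote : ∀ r ∉ Faulty, ∃ e, E.event e = .vote r b)
    (hj : E.event j = .propose (leader f b.view) b)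
    (hi : E.event i = .propose (leader f (b.view + 1)) b') (hb' : b'.view = b.view + 1) :
    b'.qc.block = b := by
  have htime : ∀ {r e}, E.event e = .vote r b → E.time i < E.time e + τ :=
    fun he => h.propose_time hFaulty hτ hn hp hGST hvote hi hb' he
  have hl := (h.legal_propose hj).1
  have hpropose := (h.legal_propose hi).2
  have hview := hpropose.view
  rw [hb'] at hview
  cases hpropose with
  | fast p batch σ hr hnew htx hσ hlen hnodup hv =>
    obtain ⟨r, hrσ, hrF⟩ := exists_honest_of_quorum hFaulty hnodup (by simpa using hlen)
    obtain ⟨x, hx, rfl⟩ := List.mem_map.1 hrσ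
    obtain ⟨hin, _, rfl⟩ := hσ x hx
    obtain ⟨k, _, q, hs⟩ := h.sends_of_mem_inbox hin rfl hrF
    have hpv : x.block.view = b.view := by omega
    obtain ⟨k', hk'⟩ := h.exists_propose_of_vote (h.sends_voteResp hrF hs).1 (by omega)
      (hpv ▸ hl)
    rw [hpv] at hk'
    -- The honest voter for `x.block` voted in view `b.view`, whose honest leader proposed only `b`.
    exact (h.propose_unique hk' hj hpv).2
  | slow p Q batch S π hr hnew htx hS hlen hnodup hchoice hπ =>
    exfalso
    obtain ⟨r, hrS, hrF⟩ := exists_honest_of_quorum hFaulty hnodup (by simpa using hlen)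
    obtain ⟨m, hm, rfl⟩ := List.mem_map.1 hrS
    obtain ⟨hin, _, hmv⟩ := hS m hm
    obtain ⟨k, hk, q, hs⟩ := h.sends_of_mem_inbox hin rfl hrF
    obtain ⟨e, he⟩ := hvote _ hrF
    -- On timeout, the timer set by the vote for `b` would have expired before the proposal, against
    -- `htime`. On advance, the view would have been entered without a vote.
    rcases h.sends_newView hrF hs with ⟨hto, hv⟩ | ⟨hadv, hv⟩
    · have hek : e < k := by
        by_contra! hke
        have h1 := h.view_mono m.signer hke
        have h2 := (h.view_after_vote he).1
        simp only at h1
        omega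
      have h1 := (h.legal_timeout hto).2.2.2 e hek b he (by omega)
      have h2 := h.time_mono hk.le
      have h3 := htime he
      linarith
    · have h1 := h.enters_of_advance hadv
      rw [← hv, hmv, ← hview] at h1
      have h2 := h.enters_unique (h.enters_of_vote he) h1
      rw [h2, hadv] at he
      cases he

theorem mem_committed_of_vote {e : ℕ} {r : Replica f} {b c d : Block f Tx}
    (he : E.event e = .vote r b) (hd : CommitRule b d) (hc : Extends c d) :
    c ∈ (E.state (e + 1) r).committed := by
  rw [h.next, he]
  simp only [Event.next, Function.update_self, LocalState.afterVote]
  exact .inr ⟨d, hd, hc⟩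

end FollowsProtocol

end Execution

end Liveness

end ChainedBFT

theorem mainTheorem4 (f : ℕ) {Tx : Type} (ok : Tx → Prop)
    (Faulty : Finset (ChainedBFT.Replica f)) (hFaulty : Faulty.card ≤ f)
    (GST Δ Tf τ : ℝ) (hτ : Tf + 2 * Δ < τ)
    (E : ChainedBFT.Execution f Tx)
    (hprotocol : E.FollowsProtocol ok Faulty τ)
    (hnetwork : E.PartiallySynchronous Faulty GST Δ)
    (hpacemaker : E.Pacemaker Faulty GST Tf)
    (v : ℕ) (hv : E.AfterGST Faulty GST v) :
    ∃ v', v < v' ∧ ∃ B : ChainedBFT.Block f Tx, B.view = v' ∧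
      ∀ r ∉ Faulty, ∃ i, B ∈ (E.state i r).committed := by
  -- Starting from `v + 2` gives both `v < w` and the bound `2 ≤ w` that entering a view requires.
  obtain ⟨w, hw, hl₀, hl₁, hl₂⟩ := ChainedBFT.exists_three_honest_leaders hFaulty (v + 2)
  have hGST : ∀ u, w ≤ u → E.AfterGST Faulty GST u := fun u hu => hv.mono (by omega)
  obtain ⟨b₀, i₀, hi₀, hb₀, hvote₀⟩ :=
    hprotocol.exists_proposal hpacemaker (by omega) (hGST w le_rfl) hl₀
  obtain ⟨b₁, i₁, hi₁, hb₁, hvote₁⟩ :=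
    hprotocol.exists_proposal hpacemaker (by omega) (hGST (w + 1) (by omega)) hl₁
  obtain ⟨b₂, i₂, hi₂, hb₂, hvote₂⟩ :=
    hprotocol.exists_proposal hpacemaker (by omega) (hGST (w + 2) (by omega)) hl₂
  subst hb₀
  have h₁ : b₁.qc.block = b₀ := hprotocol.certified_block hFaulty hτ hnetwork hpacemaker
    (hGST _ le_rfl) (by omega) hvote₀ hi₀ hi₁ hb₁
  have h₂ : b₂.qc.block = b₁ := hprotocol.certified_block hFaulty hτ hnetwork hpacemaker
    (hGST _ (by omega)) (by omega) hvote₁ (by rwa [hb₁]) (by rwa [hb₁]) (by omega)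
  refine ⟨b₀.view, by omega, b₀, rfl, fun r hr => ?_⟩
  obtain ⟨e, he⟩ := hvote₂ r hr
  -- The views of `b₀` and `b₁` are consecutive, so the stored VOTE-REQs need not be examined.
  exact ⟨e + 1, hprotocol.mem_committed_of_vote he
    ⟨by rw [h₂, h₁], .inl (by rw [h₂, hb₁])⟩ .refl⟩
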